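/- Let $G \subseteq \mathbb{R}^2$ be a convex set and let $f : G \to \mathbb{R}^2$ be a monotone mapping, that is, a mapping preserving betweenness: for all $a, x, b \in G$, if $x$ lies on the segment $[a,b]$, then $f(x)$ lies on the segment $[f(a), f(b)]$. Then exactly one of the following possibilities occurs. (1) $f(G) \subseteq L \cup \{q\}$ for some line $L \subseteq \mathbb{R}^2$ and some point $q \in \mathbb{R}^2$. (2) The image $f(G)$ has nonempty interior. (3) $f(G) = \{a,b,c,d,e\}$ for some points $a,b,c,d,e \in \mathbb{R}^2$ such that $a,b,c,d$ are convex independent (they are distinct, and none of them lies in the convex hull of the other three) and $\{e\} = [a,c] \cap [b,d]$. -/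

import Mathlib

/-- The Euclidean plane. -/
abbrev Plane : Type := EuclideanSpace ℝ (Fin 2)

/-- A map defined on a subset `X` of a real vector space is *monotone* if it preserves Euclidean
betweenness: whenever `a, x, b ∈ X` and `x` lies on the segment `[a, b]`, the point `f x` lies on
the segment `[f a, f b]`. -/
def BetweennessMonotone {V W : Type*} [AddCommGroup V] [Module ℝ V] [AddCommGroup W] [Module ℝ W]
    {X : Set V} (f : X → W) : Prop :=
  ∀ a x b : X, Wbtw ℝ (a : V) (x : V) (b : V) → Wbtw ℝ (f a) (f x) (f b)

/-- `S` is contained in the union of a line and a single point. -/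
def InLineUnionPoint (S : Set Plane) : Prop :=
  ∃ (L : AffineSubspace ℝ Plane) (q : Plane),
    Module.finrank ℝ L.direction = 1 ∧ S ⊆ (L : Set Plane) ∪ {q}

/-- `S = {a, b, c, d, e}` where `a, b, c, d` are convex independent (in particular distinct) and
`{e} = [a, c] ∩ [b, d]`. -/
def IsQuadrilateralWithCenter (S : Set Plane) : Prop :=
  ∃ a b c d e : Plane, S = {a, b, c, d, e} ∧ ConvexIndependent ℝ ![a, b, c, d] ∧
    segment ℝ a c ∩ segment ℝ b d = {e}

/-- Exactly one of three propositions holds. -/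
def ExactlyOne (p q r : Prop) : Prop :=
  (p ∨ q ∨ r) ∧ ¬(p ∧ q) ∧ ¬(p ∧ r) ∧ ¬(q ∧ r)

/-! Monotonicity makes preimages of convex sets convex, so `f` carries a Radon point of four points
into the hulls of both image classes. When the four images have no three on a line, their Radon
partition is unique, so the original points have the same one. Two consequences drive the proof. The
diagonals of a convex quadrilateral with vertices in the range meet in the range. If an image point
lies in an open triangle of image points, its preimage is a strictly positive combination of the
three preimages.

In the second situation `f` has a projective frame: in suitable homogeneous coordinates it induces a
map of the positive cone of ℝ³ that preserves betweenness of rays and fixes the rays of e₁, e₂, e₃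
and e₁+e₂+e₃. Intersecting lines, run as a subtractive Euclidean algorithm, fixes every positive
rational ray; betweenness then squeezes every real ray. Hence the whole open triangle is attained
(`openTriangle_subset_range`, `interior_range_nonempty`).

Otherwise no image point lies in an open triangle of image points. A range not covered by a line and
a point contains four points with no three collinear
(`hasGeneralQuadruple_of_not_inLineUnionPoint`). These must form a convex quadrilateral, its center
is also attained, and any further point would create a forbidden triangle
(`NoInteriorPoint.eq_of_mem`). -/

/-! ### Rays of the cone fixed by a betweenness map -/

/-- A self-map of the cone of nonnegative vectors, depending only on rays, that sends a sum of
two vectors into the cone spanned by their images. -/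
structure ConeBetweenness (H : (Fin 3 → ℝ) → Fin 3 → ℝ) : Prop where
  smul : ∀ c : ℝ, 0 < c → ∀ u, H (c • u) = H u
  ne_zero : ∀ u, 0 < u → H u ≠ 0
  add : ∀ u v, 0 < u → 0 < v → ∃ r s : ℝ, 0 ≤ r ∧ 0 ≤ s ∧ H (u + v) = r • H u + s • H v

/-- `H` maps `u` into the open ray spanned by `u`. -/
def FixesRay (H : (Fin 3 → ℝ) → Fin 3 → ℝ) (u : Fin 3 → ℝ) : Prop :=
  ∃ c : ℝ, 0 < c ∧ H u = c • u

/-- A positive linearly independent triple such that the rays of its members and of its sum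
are fixed by `H`. -/
structure FixedTriple (H : (Fin 3 → ℝ) → Fin 3 → ℝ) (u v w : Fin 3 → ℝ) : Prop where
  indep : ∀ a b c : ℝ, a • u + b • v + c • w = 0 → a = 0 ∧ b = 0 ∧ c = 0
  pos₁ : 0 < u
  pos₂ : 0 < v
  pos₃ : 0 < w
  fix₁ : FixesRay H u
  fix₂ : FixesRay H v
  fix₃ : FixesRay H w
  fix_sum : FixesRay H (u + v + w)

namespace FixedTriple

variable {H : (Fin 3 → ℝ) → Fin 3 → ℝ} {u v w : Fin 3 → ℝ}

lemma rotate (h : FixedTriple H u v w) : FixedTriple H v w u where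
  indep a b c e := by
    obtain ⟨h1, h2, h3⟩ := h.indep c a b (by rw [← e]; abel)
    exact ⟨h2, h3, h1⟩
  pos₁ := h.pos₂
  pos₂ := h.pos₃
  pos₃ := h.pos₁
  fix₁ := h.fix₂
  fix₂ := h.fix₃
  fix₃ := h.fix₁
  fix_sum := by
    have := h.fix_sum
    rwa [show v + w + u = u + v + w by abel]

lemma swap (h : FixedTriple H u v w) : FixedTriple H v u w where
  indep a b c e := by
    obtain ⟨h1, h2, h3⟩ := h.indep b a c (by rw [← e]; abel)
    exact ⟨h2, h1, h3⟩
  pos₁ := h.pos₂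
  pos₂ := h.pos₁
  pos₃ := h.pos₃
  fix₁ := h.fix₂
  fix₂ := h.fix₁
  fix₃ := h.fix₃
  fix_sum := by
    have := h.fix_sum
    rwa [show v + u + w = u + v + w by abel]

/-- The image of u+v stays in the cone of u and v. The fixed ray of u+v+w lies in the cone of that
image and w, which forces equal coefficients on u and v: projectively, u+v is where the line through
w and u+v+w meets the side uv. -/
lemma fix_add (hH : ConeBetweenness H) (h : FixedTriple H u v w) : FixesRay H (u + v) := by
  obtain ⟨r, s, hr, hs, e⟩ := hH.add u v h.pos₁ h.pos₂
  obtain ⟨r', s', hr', hs', e'⟩ := hH.add (u + v) w (add_pos h.pos₁ h.pos₂) h.pos₃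
  obtain ⟨a, ha, ea⟩ := h.fix₁
  obtain ⟨b, hb, eb⟩ := h.fix₂
  obtain ⟨c, hc, ec⟩ := h.fix₃
  obtain ⟨d, hd, ed⟩ := h.fix_sum
  rw [ea, eb] at e
  rw [e, ec, ed] at e'
  obtain ⟨h1, h2, -⟩ := h.indep (d - r' * (r * a)) (d - r' * (s * b)) (d - s' * c) (by
    rw [← sub_eq_zero] at e'
    rw [← e']
    module)
  have hr'0 : r' ≠ 0 := by
    rintro rfl
    simp at h1
    exact hd.ne' h1
  have h3 : r * a = s * b := mul_left_cancel₀ hr'0 (by linarith)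
  refine ⟨r * a, ?_, ?_⟩
  · rcases (mul_nonneg hr ha.le).eq_or_lt with h0 | h0
    · rw [← h0] at h1
      simp at h1
      exact absurd h1 hd.ne'
    · exact h0
  · rw [e, smul_smul, smul_smul, ← h3, smul_add]

/-- The ray of u+2v+w is the intersection of the line through u+v and v+w with the line through
u+v+w and v, all four of which are fixed. This is the sum of the triple in `add_right`. -/
lemma fix_add_two (hH : ConeBetweenness H) (h : FixedTriple H u v w) :
    FixesRay H (u + v + (v + w)) := by
  obtain ⟨a, ha, ea⟩ := h.fix_add hH
  obtain ⟨b, hb, eb⟩ := h.rotate.fix_add hH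
  obtain ⟨c, hc, ec⟩ := h.fix_sum
  obtain ⟨d, hd, ed⟩ := h.fix₂
  obtain ⟨r, s, hr, hs, e⟩ := hH.add (u + v) (v + w) (add_pos h.pos₁ h.pos₂)
    (add_pos h.pos₂ h.pos₃)
  obtain ⟨r', s', hr', hs', e'⟩ := hH.add (u + v + w) v
    (add_pos (add_pos h.pos₁ h.pos₂) h.pos₃) h.pos₂
  have hne := hH.ne_zero (u + v + (v + w))
    (add_pos (add_pos h.pos₁ h.pos₂) (add_pos h.pos₂ h.pos₃))
  rw [show u + v + w + v = u + v + (v + w) by abel, ec, ed] at e'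
  rw [ea, eb] at e
  obtain ⟨h1, -, h3⟩ := h.indep (r * a - r' * c) (r * a + s * b - r' * c - s' * d)
    (s * b - r' * c) (by
      rw [← sub_eq_zero.mpr (e.symm.trans e')]
      module)
  have h4 : s * b = r * a := by linarith
  have h5 : H (u + v + (v + w)) = (r * a) • (u + v + (v + w)) := by
    rw [e, smul_smul, smul_smul, h4, ← smul_add]
  refine ⟨r * a, ?_, h5⟩
  rcases (mul_nonneg hr ha.le).eq_or_lt with h0 | h0
  · rw [← h0, zero_smul] at h5
    exact absurd h5 hne
  · exact h0

lemma add_right (hH : ConeBetweenness H) (h : FixedTriple H u v w) :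
    FixedTriple H u v (v + w) where
  indep a b c e := by
    obtain ⟨h1, h2, h3⟩ := h.indep a (b + c) c (by rw [← e]; module)
    subst h3
    exact ⟨h1, by simpa using h2, rfl⟩
  pos₁ := h.pos₁
  pos₂ := h.pos₂
  pos₃ := add_pos h.pos₂ h.pos₃
  fix₁ := h.fix₁
  fix₂ := h.fix₂
  fix₃ := h.rotate.fix_add hH
  fix_sum := h.fix_add_two hH

lemma fixesRay_smul (hH : ConeBetweenness H) {c : ℝ} (hc : 0 < c) (h : FixesRay H u) :
    FixesRay H (c • u) := by
  obtain ⟨a, ha, e⟩ := h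
  exact ⟨a / c, div_pos ha hc, by rw [hH.smul c hc, e, smul_smul, div_mul_cancel₀ _ hc.ne']⟩

/-- The subtractive Euclidean algorithm: all natural combinations of a fixed triple are fixed. -/
lemma fixesRay_nat (hH : ConeBetweenness H) (n : ℕ) :
    ∀ {u v w : Fin 3 → ℝ}, FixedTriple H u v w → ∀ a b c : ℕ, a + b + c = n → 0 < n →
      FixesRay H ((a : ℝ) • u + (b : ℝ) • v + (c : ℝ) • w) := by
  induction n using Nat.strong_induction_on with
  | _ n ih =>
    have key : ∀ {u v w : Fin 3 → ℝ}, FixedTriple H u v w → ∀ a b c : ℕ, a + b + c = n →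
        0 < b → b ≤ c → FixesRay H ((a : ℝ) • u + (b : ℝ) • v + (c : ℝ) • w) := by
      intro u v w h a b c hn hb hbc
      -- Euclidean step: bv + cw = (c-b)w + b(w+v), and the coefficient total drops by b.
      have := ih (a + (c - b) + b) (by omega) (h.swap.rotate.add_right hH) a (c - b) b rfl
        (by omega)
      rw [Nat.cast_sub hbc] at this
      convert this using 1
      module
    have key' : ∀ {u v w : Fin 3 → ℝ}, FixedTriple H u v w → ∀ a b c : ℕ, a + b + c = n →
        0 < b → 0 < c → FixesRay H ((a : ℝ) • u + (b : ℝ) • v + (c : ℝ) • w) := by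
      intro u v w h a b c hn hb hc
      rcases le_total b c with hbc | hbc
      · exact key h a b c hn hb hbc
      · convert key h.swap.rotate a c b (by omega) hc hbc using 1
        abel
    intro u v w h a b c hn hpos
    rcases Nat.eq_zero_or_pos a with ha | ha <;> rcases Nat.eq_zero_or_pos b with hb | hb <;>
      rcases Nat.eq_zero_or_pos c with hc | hc
    · omega
    · subst ha hb
      simpa using fixesRay_smul hH (Nat.cast_pos.mpr hc) h.fix₃
    · subst ha hc
      simpa using fixesRay_smul hH (Nat.cast_pos.mpr hb) h.fix₂
    · exact key' h a b c hn hb hc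
    · subst hb hc
      simpa using fixesRay_smul hH (Nat.cast_pos.mpr ha) h.fix₁
    · convert key' h.rotate b c a (by omega) hc ha using 1
      abel
    · convert key' h.rotate.rotate c a b (by omega) ha hb using 1
      abel
    · exact key' h a b c hn hb hc

end FixedTriple

/-! ### From rational rays to real rays -/

namespace ConeBetweenness

open Function

variable {H : (Fin 3 → ℝ) → Fin 3 → ℝ}

lemma fixesRay_rat (hH : ConeBetweenness H)
    (h : FixedTriple H (Pi.single 0 1) (Pi.single 1 1) (Pi.single 2 1))
    (q : Fin 3 → ℚ) (hq : ∀ i, 0 < q i) : FixesRay H (fun i => (q i : ℝ)) := by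
  have hnum : ∀ i, ((q i).num.toNat : ℚ) = q i * (q i).den := by
    intro i
    have h1 : ((q i).num.toNat : ℤ) = (q i).num := Int.toNat_of_nonneg (Rat.num_nonneg.mpr (hq i).le)
    have h2 : ((q i).num.toNat : ℚ) = ((q i).num : ℚ) := by exact_mod_cast h1
    rw [h2, Rat.mul_den_eq_num]
  have hnum' : ∀ i, ((q i).num.toNat : ℝ) = q i * (q i).den := fun i => by exact_mod_cast hnum i
  set D : Fin 3 → ℕ := fun i => (q i).den
  set N : Fin 3 → ℕ := fun i => (q i).num.toNat
  have hD : ∀ i, 0 < D i := fun i => (q i).den_pos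
  have hN : ∀ i, 0 < N i := fun i => by
    have : (0 : ℚ) < N i := by
      rw [hnum]
      exact mul_pos (hq i) (Nat.cast_pos.mpr (hD i))
    exact_mod_cast this
  have hpos : 0 < N 0 * D 1 * D 2 + N 1 * D 0 * D 2 + N 2 * D 0 * D 1 := by
    have := hN 0; have := hD 1; have := hD 2
    positivity
  have := FixedTriple.fixesRay_nat hH _ h (N 0 * D 1 * D 2) (N 1 * D 0 * D 2) (N 2 * D 0 * D 1)
    rfl hpos
  have hprod : (0 : ℝ) < D 0 * D 1 * D 2 := by
    have := hD 0; have := hD 1; have := hD 2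
    positivity
  have e := FixedTriple.fixesRay_smul hH (inv_pos.mpr hprod) this
  convert e using 1
  have n0 := hnum' 0
  have n1 := hnum' 1
  have n2 := hnum' 2
  have d0 : (D 0 : ℝ) ≠ 0 := Nat.cast_ne_zero.mpr (hD 0).ne'
  have d1 : (D 1 : ℝ) ≠ 0 := Nat.cast_ne_zero.mpr (hD 1).ne'
  have d2 : (D 2 : ℝ) ≠ 0 := Nat.cast_ne_zero.mpr (hD 2).ne'
  change (N 0 : ℝ) = q 0 * D 0 at n0
  change (N 1 : ℝ) = q 1 * D 1 at n1
  change (N 2 : ℝ) = q 2 * D 2 at n2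
  funext i
  fin_cases i <;> simp [n0, n1, n2] <;> field_simp

/-- Since L > 0 is an open condition, coordinate i can be moved to rationals on both sides of `u i`
without leaving it. A positive multiple of u is a positive combination of the two moved vectors, so
H u lies in the cone of their images. Applied once per coordinate, this reduces to rational vectors.
-/
lemma nonneg_of_update (hH : ConeBetweenness H) (L : (Fin 3 → ℝ) →ₗ[ℝ] ℝ) (u : Fin 3 → ℝ)
    (i : Fin 3) (hu : ∀ j, 0 < u j) (hL : 0 < L u)
    (h : ∀ q : ℚ, 0 < q → 0 < L (update u i q) → 0 ≤ L (H (update u i q))) : 0 ≤ L (H u) := by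
  have hupd : ∀ t : ℝ, update u i t = u + (t - u i) • Pi.single i (1 : ℝ) := by
    intro t
    funext j
    by_cases hj : j = i
    · subst hj; simp
    · simp [hj]
  have hLu : ∀ t : ℝ, L (update u i t) = L u + (t - u i) * L (Pi.single i (1 : ℝ)) := by
    intro t
    rw [hupd, map_add, map_smul, smul_eq_mul]
  have hopen : IsOpen {t : ℝ | 0 < t ∧ 0 < L u + (t - u i) * L (Pi.single i (1 : ℝ))} :=
    (isOpen_lt continuous_const continuous_id).inter
      (isOpen_lt continuous_const
        (by fun_prop : Continuous fun t : ℝ => L u + (t - u i) * L (Pi.single i (1 : ℝ))))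
  obtain ⟨l, m, hlm, hsub⟩ := mem_nhds_iff_exists_Ioo_subset.mp
    (hopen.mem_nhds (show u i ∈ _ from ⟨hu i, by simpa using hL⟩))
  obtain ⟨q₁, h₁, h₁'⟩ := exists_rat_btwn hlm.1
  obtain ⟨q₂, h₂, h₂'⟩ := exists_rat_btwn hlm.2
  have m₁ := hsub (show (q₁ : ℝ) ∈ Set.Ioo l m from ⟨h₁, h₁'.trans hlm.2⟩)
  have m₂ := hsub (show (q₂ : ℝ) ∈ Set.Ioo l m from ⟨hlm.1.trans h₂, h₂'⟩)
  have g₁ := h q₁ (by exact_mod_cast m₁.1) (by rw [hLu]; exact m₁.2)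
  have g₂ := h q₂ (by exact_mod_cast m₂.1) (by rw [hLu]; exact m₂.2)
  have hpos : ∀ t : ℝ, 0 < t → ∀ c : ℝ, 0 < c → 0 < c • update u i t := by
    intro t ht c hc
    have : ∀ j, 0 < (c • update u i t) j := by
      intro j
      refine mul_pos hc ?_
      by_cases hj : j = i
      · subst hj; simpa using ht
      · simpa [hj] using hu j
    exact lt_of_le_of_ne (fun j => (this j).le) fun e => (this 0).ne (congrFun e 0)
  have c₁ : 0 < (q₂ : ℝ) - u i := by linarith
  have c₂ : 0 < u i - (q₁ : ℝ) := by linarith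
  obtain ⟨r, s, hr, hs, e⟩ := hH.add _ _ (hpos _ m₁.1 _ c₁) (hpos _ m₂.1 _ c₂)
  have hcomb : ((q₂ : ℝ) - u i) • update u i (q₁ : ℝ) + (u i - (q₁ : ℝ)) • update u i (q₂ : ℝ)
      = ((q₂ : ℝ) - q₁) • u := by
    rw [hupd, hupd]
    module
  rw [hcomb, hH.smul _ (by linarith), hH.smul _ c₁, hH.smul _ c₂] at e
  rw [e, map_add, map_smul, map_smul]
  exact add_nonneg (mul_nonneg hr g₁) (mul_nonneg hs g₂)

lemma nonneg_of_pos (hH : ConeBetweenness H)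
    (h : FixedTriple H (Pi.single 0 1) (Pi.single 1 1) (Pi.single 2 1))
    (L : (Fin 3 → ℝ) →ₗ[ℝ] ℝ) (u : Fin 3 → ℝ) (hu : ∀ j, 0 < u j) (hL : 0 < L u) :
    0 ≤ L (H u) := by
  have hpos : ∀ u : Fin 3 → ℝ, (∀ j, 0 < u j) → ∀ i, ∀ q : ℚ, 0 < q →
      ∀ j, 0 < update u i (q : ℝ) j := by
    intro u hu i q hq j
    by_cases hj : j = i
    · subst hj; simpa using hq
    · simpa [hj] using hu j
  refine hH.nonneg_of_update L u 0 hu hL fun q₀ h₀ l₀ => ?_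
  have p₀ := hpos _ hu 0 q₀ h₀
  refine hH.nonneg_of_update L _ 1 p₀ l₀ fun q₁ h₁ l₁ => ?_
  have p₁ := hpos _ p₀ 1 q₁ h₁
  refine hH.nonneg_of_update L _ 2 p₁ l₁ fun q₂ h₂ l₂ => ?_
  have e : update (update (update u 0 (q₀ : ℝ)) 1 (q₁ : ℝ)) 2 (q₂ : ℝ)
      = fun i => ((![q₀, q₁, q₂] i : ℚ) : ℝ) := by
    funext i
    fin_cases i <;> simp [update]
  rw [e] at l₂ ⊢
  obtain ⟨c, hc, e'⟩ := hH.fixesRay_rat h ![q₀, q₁, q₂] (by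
    intro i
    fin_cases i
    exacts [h₀, h₁, h₂])
  rw [e', map_smul]
  exact mul_nonneg hc.le l₂.le

/-- A betweenness map of the cone that fixes the rays of the basis vectors and of their sum
fixes every ray in the interior. -/
theorem fixesRay_of_pos (hH : ConeBetweenness H)
    (h : FixedTriple H (Pi.single 0 1) (Pi.single 1 1) (Pi.single 2 1))
    (u : Fin 3 → ℝ) (hu : ∀ j, 0 < u j) : ∃ c : ℝ, H u = c • u := by
  have key : ∀ i j, u i * H u j ≤ u j * H u i := by
    intro i j
    refine le_of_forall_pos_le_add fun ε hε => ?_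
    by_contra! hlt
    have hH0 : 0 ≤ H u 0 := by
      have := hH.nonneg_of_pos h (LinearMap.proj 0) u hu (hu 0)
      simpa using this
    -- The functional u_j x_i - u_i x_j vanishes at u. Adding δ x_0 makes it positive there, and
    -- this δ keeps the error δ · H u 0 below ε.
    set δ := ε / (H u 0 + 1) with hδ
    have hδ0 : 0 < δ := by positivity
    have := hH.nonneg_of_pos h
      (u j • LinearMap.proj i - u i • LinearMap.proj j + δ • LinearMap.proj 0) u hu (by
        have := mul_pos hδ0 (hu 0)
        simp only [LinearMap.add_apply, LinearMap.sub_apply, LinearMap.smul_apply,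
          LinearMap.proj_apply, smul_eq_mul]
        linarith [mul_comm (u i) (u j)])
    simp only [LinearMap.add_apply, LinearMap.sub_apply, LinearMap.smul_apply,
      LinearMap.proj_apply, smul_eq_mul] at this
    have h2 : δ * (H u 0 + 1) = ε := by rw [hδ]; field_simp
    linarith
  refine ⟨H u 0 / u 0, funext fun i => ?_⟩
  have := le_antisymm (key 0 i) (key i 0)
  have h0 := (hu 0).ne'
  simp only [Pi.smul_apply, smul_eq_mul]
  field_simp
  linarith

end ConeBetweenness

/-! ### Filling an open triangle -/

namespace BetweennessMonotone

lemma map_mem_convexHull {G : Set Plane} (hG : Convex ℝ G) {f : G → Plane}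
    (hf : BetweennessMonotone f) {ι : Type*} (x : ι → G) (s : Set ι) (z : G)
    (hz : (z : Plane) ∈ convexHull ℝ ((fun i => (x i : Plane)) '' s)) :
    f z ∈ convexHull ℝ ((fun i => f (x i)) '' s) := by
  set C := convexHull ℝ ((fun i => f (x i)) '' s) with hC
  -- The preimage of a convex set is convex, and this one contains all the chosen points.
  have hK : Convex ℝ {v : Plane | ∃ h : v ∈ G, f ⟨v, h⟩ ∈ C} := by
    rw [convex_iff_segment_subset]
    rintro a ⟨ha, fa⟩ b ⟨hb, fb⟩ c hc
    have hcG := hG.segment_subset ha hb hc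
    refine ⟨hcG, ?_⟩
    have := hf ⟨a, ha⟩ ⟨c, hcG⟩ ⟨b, hb⟩ (mem_segment_iff_wbtw.mp hc)
    exact (convex_convexHull ℝ _).segment_subset fa fb (mem_segment_iff_wbtw.mpr this)
  have hsub : (fun i => (x i : Plane)) '' s ⊆ {v : Plane | ∃ h : v ∈ G, f ⟨v, h⟩ ∈ C} := by
    rintro _ ⟨i, hi, rfl⟩
    exact ⟨(x i).2, subset_convexHull ℝ _ ⟨i, hi, rfl⟩⟩
  obtain ⟨_, h⟩ := convexHull_min hsub hK hz
  exact h

/-- If the image of `p` is interior to the triangle spanned by the images of `x 0, x 1, x 2`,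
and `p` is a strictly positive combination of these points, then the whole open triangle is
contained in the range. -/
theorem openTriangle_subset_range {G : Set Plane} (hG : Convex ℝ G) {f : G → Plane}
    (hf : BetweennessMonotone f) (b : AffineBasis (Fin 3) ℝ Plane) (x : Fin 3 → G) (p : G)
    (hx : ∀ i, f (x i) = b i) (hp : ∀ i, 0 < b.coord i (f p)) (α : Fin 3 → ℝ)
    (hα : ∀ i, 0 < α i) (hα1 : ∑ i, α i = 1) (hαp : ∑ i, α i • (x i : Plane) = p) :
    {y | ∀ i, 0 < b.coord i y} ⊆ Set.range f := by
  classical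
  -- The value 0 off G is irrelevant: `Φ` below sends positive vectors into G.
  set F : Plane → Plane := fun v => if h : v ∈ G then f ⟨v, h⟩ else 0 with hF
  have hFG : ∀ v (h : v ∈ G), F v = f ⟨v, h⟩ := fun v h => dif_pos h
  -- `Φ u` is the center of mass of the x i with masses α i * u i. The factors α i make the all-ones
  -- vector represent p; independence of the x i is not needed.
  set M : (Fin 3 → ℝ) → ℝ := fun u => ∑ i, α i * u i with hM
  set N : (Fin 3 → ℝ) → Plane := fun u => ∑ i, (α i * u i) • (x i : Plane) with hN
  set Φ : (Fin 3 → ℝ) → Plane := fun u => (M u)⁻¹ • N u with hΦ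
  have hMadd : ∀ u v, M (u + v) = M u + M v := fun u v => by
    simp [hM, mul_add, Finset.sum_add_distrib]
  have hNadd : ∀ u v, N (u + v) = N u + N v := fun u v => by
    simp [hN, mul_add, add_smul, Finset.sum_add_distrib]
  have hMsmul : ∀ (c : ℝ) u, M (c • u) = c * M u := fun c u => by
    simp only [hM, Pi.smul_apply, smul_eq_mul, Finset.mul_sum]
    exact Finset.sum_congr rfl fun i _ => by ring
  have hNsmul : ∀ (c : ℝ) u, N (c • u) = c • N u := fun c u => by
    simp only [hN, Pi.smul_apply, smul_eq_mul, Finset.smul_sum]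
    exact Finset.sum_congr rfl fun i _ => by module
  have hMpos : ∀ u, 0 < u → 0 < M u := by
    intro u hu
    obtain ⟨h0, i, hi⟩ := Pi.lt_def.mp hu
    exact Finset.sum_pos' (fun j _ => mul_nonneg (hα j).le (h0 j))
      ⟨i, Finset.mem_univ _, mul_pos (hα i) hi⟩
  have hΦG : ∀ u, 0 < u → Φ u ∈ G := by
    intro u hu
    exact hG.centerMass_mem (t := Finset.univ) (w := fun i => α i * u i) (z := fun i => (x i : Plane))
      (fun j _ => mul_nonneg (hα j).le (hu.le j)) (hMpos u hu) (fun j _ => (x j).2)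
  have hβ : ∀ i, b.coord i (f p) ≠ 0 := fun i => (hp i).ne'
  -- Dividing by the coordinates of `f p` makes the all-ones vector represent `f p` in the target as
  -- well, so `H` fixes it.
  set H : (Fin 3 → ℝ) → Fin 3 → ℝ := fun u i => b.coord i (F (Φ u)) / b.coord i (f p) with hH
  have hHsum : ∀ u, ∑ i, H u i * b.coord i (f p) = 1 := by
    intro u
    simp only [hH]
    rw [← b.sum_coord_apply_eq_one (F (Φ u))]
    exact Finset.sum_congr rfl fun i _ => div_mul_cancel₀ _ (hβ i)
  have hcone : ConeBetweenness H := by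
    refine ⟨fun c hc u => ?_, fun u _ h0 => ?_, fun u v hu hv => ?_⟩
    · have : Φ (c • u) = Φ u := by
        simp only [hΦ, hMsmul, hNsmul]
        rw [smul_smul, mul_inv, mul_right_comm, inv_mul_cancel₀ hc.ne', one_mul]
      simp only [hH, this]
    · have := hHsum u
      rw [h0] at this
      simp at this
    · have huv : 0 < u + v := add_pos hu hv
      have m₁ := hMpos u hu
      have m₂ := hMpos v hv
      have hw : Wbtw ℝ (Φ u) (Φ (u + v)) (Φ v) := by
        rw [← mem_segment_iff_wbtw]
        refine ⟨M u / (M u + M v), M v / (M u + M v), by positivity, by positivity,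
          by field_simp, ?_⟩
        simp only [hΦ, hMadd, hNadd, smul_smul, smul_add]
        congr 2 <;> field_simp
      obtain ⟨t, ht, e⟩ := hf ⟨_, hΦG u hu⟩ ⟨_, hΦG _ huv⟩ ⟨_, hΦG v hv⟩ hw
      rw [← hFG, ← hFG, ← hFG] at e
      refine ⟨1 - t, t, sub_nonneg.mpr ht.2, ht.1, funext fun i => ?_⟩
      simp only [hH, Pi.add_apply, Pi.smul_apply, smul_eq_mul]
      rw [← e, AffineMap.apply_lineMap, AffineMap.lineMap_apply_ring]
      ring
  have hsingle : ∀ i, (0 : Fin 3 → ℝ) < Pi.single i 1 := fun i => by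
    rw [Pi.lt_def]
    refine ⟨fun j => ?_, i, by simp⟩
    by_cases hj : j = i
    · subst hj; simp
    · simp [hj]
  have hfixsingle : ∀ i, FixesRay H (Pi.single i 1) := by
    intro i
    have hΦi : Φ (Pi.single i 1) = x i := by
      simp only [hΦ, hM, hN, Pi.single_apply, mul_ite, mul_one, mul_zero, ite_smul, zero_smul,
        Finset.sum_ite_eq', Finset.mem_univ, if_true]
      rw [inv_smul_smul₀ (hα i).ne']
    refine ⟨(b.coord i (f p))⁻¹, inv_pos.mpr (hp i), funext fun j => ?_⟩
    simp only [hH, hΦi, hFG _ (x i).2, Subtype.coe_eta, hx, Pi.smul_apply, smul_eq_mul]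
    rw [b.coord_apply]
    by_cases hj : j = i
    · subst hj; simp
    · simp [hj]
  have hfixsum : FixesRay H (Pi.single 0 1 + Pi.single 1 1 + Pi.single 2 1) := by
    have e : (Pi.single 0 1 + Pi.single 1 1 + Pi.single 2 1 : Fin 3 → ℝ) = fun _ => 1 := by
      funext i
      fin_cases i <;> simp
    rw [e]
    have hΦ1 : Φ (fun _ => 1) = p := by
      simp only [hΦ, hM, hN, mul_one, hα1, hαp, inv_one, one_smul]
    refine ⟨1, one_pos, funext fun j => ?_⟩
    simp only [hH, hΦ1, hFG _ p.2, Subtype.coe_eta, Pi.smul_apply, smul_eq_mul, mul_one]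
    exact div_self (hβ j)
  have htriple : FixedTriple H (Pi.single 0 1) (Pi.single 1 1) (Pi.single 2 1) := by
    refine ⟨fun a b c h => ?_, hsingle 0, hsingle 1, hsingle 2, hfixsingle 0, hfixsingle 1,
      hfixsingle 2, hfixsum⟩
    exact ⟨by simpa using congrFun h 0, by simpa using congrFun h 1, by simpa using congrFun h 2⟩
  intro y hy
  set r : Fin 3 → ℝ := fun i => b.coord i y / b.coord i (f p) with hr
  have hrpos : ∀ i, 0 < r i := fun i => div_pos (hy i) (hp i)
  obtain ⟨c, hc⟩ := hcone.fixesRay_of_pos htriple r hrpos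
  have hrG : Φ r ∈ G := hΦG r (Pi.lt_def.mpr ⟨fun i => (hrpos i).le, 0, hrpos 0⟩)
  have hcoord : ∀ i, b.coord i (F (Φ r)) = c * b.coord i y := by
    intro i
    have := congrFun hc i
    simp only [hH, hr, Pi.smul_apply, smul_eq_mul] at this
    have h := hβ i
    field_simp at this
    linarith
  -- Both points have barycentric coordinates of sum one, so equal rays mean equal points.
  have hc1 : c = 1 := by
    have h1 := b.sum_coord_apply_eq_one (F (Φ r))
    simp only [hcoord] at h1
    rw [← Finset.mul_sum, b.sum_coord_apply_eq_one, mul_one] at h1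
    exact h1
  refine ⟨⟨Φ r, hrG⟩, ?_⟩
  rw [← hFG]
  refine b.ext_elem fun i => ?_
  rw [hcoord, hc1, one_mul]

end BetweennessMonotone

/-! ### Barycentric coordinates by Cramer's rule -/

/-- Twice the signed area of the triangle `a b c`. -/
def area (a b c : Plane) : ℝ := (b 0 - a 0) * (c 1 - a 1) - (b 1 - a 1) * (c 0 - a 0)

lemma area_rotate (a b c : Plane) : area b c a = area a b c := by
  unfold area; ring

lemma area_swap (a b c : Plane) : area b a c = -area a b c := by
  unfold area; ring

lemma weights_eq_zero_of_area_ne_zero {a b c : Plane} (h : area a b c ≠ 0) {r s t : ℝ}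
    (h0 : r + s + t = 0) (h1 : r • a + s • b + t • c = 0) : r = 0 ∧ s = 0 ∧ t = 0 := by
  have e0 := congrArg (fun v : Plane => v 0) h1
  have e1 := congrArg (fun v : Plane => v 1) h1
  simp only [PiLp.add_apply, PiLp.smul_apply, PiLp.zero_apply, smul_eq_mul] at e0 e1
  have ht : t = -r - s := by linarith
  subst ht
  refine ⟨?_, ?_, ?_⟩ <;> refine (mul_eq_zero.mp ?_).resolve_right h <;> unfold area
  · linear_combination (b 1 - c 1) * e0 - (b 0 - c 0) * e1
  · linear_combination (c 1 - a 1) * e0 - (c 0 - a 0) * e1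
  · linear_combination (a 1 - b 1) * e0 - (a 0 - b 0) * e1

lemma exists_weights_of_area_ne_zero {a b c : Plane} (h : area a b c ≠ 0) (x : Plane) :
    ∃ r s t : ℝ, r + s + t = 1 ∧ x = r • a + s • b + t • c := by
  refine ⟨area x b c / area a b c, area a x c / area a b c, area a b x / area a b c, ?_, ?_⟩
  · field_simp
    unfold area
    ring
  · ext i
    simp only [PiLp.add_apply, PiLp.smul_apply, smul_eq_mul]
    field_simp
    fin_cases i <;> simp [area] <;> ring

lemma affineIndependent_of_area_ne_zero {p : Fin 3 → Plane} (h : area (p 0) (p 1) (p 2) ≠ 0) :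
    AffineIndependent ℝ p := by
  rw [affineIndependent_iff_of_fintype]
  intro w hw hp
  rw [Finset.weightedVSub_eq_linear_combination _ hw] at hp
  simp only [Fin.sum_univ_three] at hw hp
  obtain ⟨h0, h1, h2⟩ := weights_eq_zero_of_area_ne_zero h hw hp
  intro i
  fin_cases i
  exacts [h0, h1, h2]

lemma exists_weights_of_mem_convexHull_image {ι : Type*} [Fintype ι] {V : Type*} [AddCommGroup V]
    [Module ℝ V] (g : ι → V) (I : Set ι) {v : V} (hv : v ∈ convexHull ℝ (g '' I)) :
    ∃ w : ι → ℝ, (∀ i, 0 ≤ w i) ∧ (∀ i, i ∉ I → w i = 0) ∧ ∑ i, w i = 1 ∧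
      ∑ i, w i • g i = v := by
  classical
  suffices h : convexHull ℝ (g '' I) ⊆ {v | ∃ w : ι → ℝ, (∀ i, 0 ≤ w i) ∧
      (∀ i, i ∉ I → w i = 0) ∧ ∑ i, w i = 1 ∧ ∑ i, w i • g i = v} from h hv
  refine convexHull_min ?_ ?_
  · rintro _ ⟨i, hi, rfl⟩
    refine ⟨Pi.single i 1, fun j => ?_, fun j hj => ?_, by simp, by simp [Pi.single_apply]⟩
    · by_cases hj : j = i
      · subst hj; simp
      · simp [hj]
    · rw [Pi.single_eq_of_ne]
      rintro rfl
      exact hj hi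
  · rintro _ ⟨w, w0, wI, w1, rfl⟩ _ ⟨w', w0', wI', w1', rfl⟩ r s hr hs hrs
    refine ⟨r • w + s • w', fun i => ?_, fun i hi => ?_, ?_, ?_⟩
    · exact add_nonneg (mul_nonneg hr (w0 i)) (mul_nonneg hs (w0' i))
    · simp [wI i hi, wI' i hi]
    · simp [Finset.sum_add_distrib, ← Finset.mul_sum, w1, w1', hrs]
    · simp [Finset.sum_add_distrib, add_smul, mul_smul, ← Finset.smul_sum]

/-! ### Radon partitions and their images -/

namespace BetweennessMonotone

/-- The Radon partition of four points is determined by the signs of the weights expressing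
one of the image points through the other three. -/
lemma exists_radon_point {G : Set Plane} (hG : Convex ℝ G) {f : G → Plane}
    (hf : BetweennessMonotone f) (x : Fin 4 → G) (w : Fin 3 → ℝ) (hw : ∀ i, w i ≠ 0)
    (hw1 : w 0 + w 1 + w 2 = 1) (hA : area (f (x 0)) (f (x 1)) (f (x 2)) ≠ 0)
    (hx : f (x 3) = w 0 • f (x 0) + w 1 • f (x 1) + w 2 • f (x 2)) :
    ∃ (I : Set (Fin 4)) (z : G), 3 ∈ I ∧ (∀ i : Fin 3, i.castSucc ∈ I ↔ w i < 0) ∧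
      (z : Plane) ∈ convexHull ℝ ((fun i => (x i : Plane)) '' I) ∧
      (z : Plane) ∈ convexHull ℝ ((fun i => (x i : Plane)) '' Iᶜ) := by
  have hdep : ¬ AffineIndependent ℝ (fun i => (x i : Plane)) := by
    intro h
    have h1 := h.card_le_finrank_succ
    have h2 := Submodule.finrank_le (vectorSpan ℝ (Set.range fun i => (x i : Plane)))
    simp at h1 h2
    omega
  obtain ⟨J, z, hz⟩ := Convex.radon_partition hdep
  obtain ⟨I, h3, hI, hIc⟩ : ∃ I : Set (Fin 4), 3 ∈ I ∧
      z ∈ convexHull ℝ ((fun i => (x i : Plane)) '' I) ∧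
      z ∈ convexHull ℝ ((fun i => (x i : Plane)) '' Iᶜ) := by
    by_cases h : (3 : Fin 4) ∈ J
    · exact ⟨J, h, hz.1, hz.2⟩
    · exact ⟨Jᶜ, h, hz.2, by rw [compl_compl]; exact hz.1⟩
  have hzG : z ∈ G := by
    refine convexHull_min ?_ hG hI
    rintro _ ⟨i, -, rfl⟩
    exact (x i).2
  refine ⟨I, ⟨z, hzG⟩, h3, ?_, hI, hIc⟩
  obtain ⟨l, l0, lI, l1, hl⟩ := exists_weights_of_mem_convexHull_image _ _
    (hf.map_mem_convexHull hG x I ⟨z, hzG⟩ hI)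
  obtain ⟨m, m0, mI, m1, hm⟩ := exists_weights_of_mem_convexHull_image _ _
    (hf.map_mem_convexHull hG x Iᶜ ⟨z, hzG⟩ hIc)
  simp only [Fin.sum_univ_four] at l1 hl m1 hm
  have m3 : m 3 = 0 := mI 3 (by simpa using h3)
  rw [hx] at hl hm
  -- The two expressions of `f z`, one from each hull, are compared in barycentric coordinates of
  -- the first three images.
  obtain ⟨e0, e1, e2⟩ := weights_eq_zero_of_area_ne_zero hA
    (r := l 0 - m 0 + w 0 * l 3) (s := l 1 - m 1 + w 1 * l 3) (t := l 2 - m 2 + w 2 * l 3)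
    (by linear_combination l1 - m1 + l 3 * hw1 + m3) (by
      rw [m3] at hm
      rw [← sub_eq_zero.mpr (hl.trans hm.symm)]
      module)
  have hdisj : ∀ i, l i = 0 ∨ m i = 0 := by
    intro i
    by_cases hi : i ∈ I
    · exact .inr (mI i (by simpa using hi))
    · exact .inl (lI i hi)
  -- If l 3 vanished, l and m would agree; having disjoint supports, both would be zero.
  have l3 : 0 < l 3 := by
    refine (l0 3).lt_of_ne' fun h => ?_
    rw [h] at e0 e1 e2 l1
    have z0 : l 0 = 0 := by rcases hdisj 0 with h | h <;> linarith
    have z1 : l 1 = 0 := by rcases hdisj 1 with h | h <;> linarith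
    have z2 : l 2 = 0 := by rcases hdisj 2 with h | h <;> linarith
    linarith
  have key : ∀ i : Fin 3, l i.castSucc - m i.castSucc + w i * l 3 = 0 := by
    intro i
    fin_cases i
    exacts [e0, e1, e2]
  intro i
  constructor
  · intro hi
    have h1 := key i
    rw [mI _ (by simpa using hi)] at h1
    have h2 := l0 i.castSucc
    by_contra! hn
    have := mul_pos ((hn).lt_of_ne' (hw i)) l3
    linarith
  · intro hi
    by_contra hn
    have h1 := key i
    rw [lI _ hn] at h1
    have h2 := m0 i.castSucc
    have := mul_neg_of_neg_of_pos hi l3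
    linarith

/-- If a point of the range is in the open triangle spanned by three others, then the range has
nonempty interior. -/
theorem interior_range_nonempty {G : Set Plane} (hG : Convex ℝ G) {f : G → Plane}
    (hf : BetweennessMonotone f) {a b c p : Plane} (ha : a ∈ Set.range f) (hb : b ∈ Set.range f)
    (hc : c ∈ Set.range f) (hp : p ∈ Set.range f) (hA : area a b c ≠ 0) {r s t : ℝ}
    (hr : 0 < r) (hs : 0 < s) (ht : 0 < t) (h1 : r + s + t = 1)
    (hpe : p = r • a + s • b + t • c) : (interior (Set.range f)).Nonempty := by
  obtain ⟨a, rfl⟩ := ha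
  obtain ⟨b, rfl⟩ := hb
  obtain ⟨c, rfl⟩ := hc
  obtain ⟨p, rfl⟩ := hp
  have hwpos : ∀ i, 0 < ![r, s, t] i := by
    intro i
    fin_cases i
    exacts [hr, hs, ht]
  obtain ⟨I, z, h3, hI, hz, hz'⟩ := hf.exists_radon_point hG ![a, b, c, p] ![r, s, t]
    (fun i => (hwpos i).ne') h1 hA hpe
  set x : Fin 3 → G := ![a, b, c] with hx
  -- With all weights positive, p is alone in its Radon class, so z = p lies in the hull of the
  -- other three.
  have hIeq : I = {3} := by
    ext i
    induction i using Fin.lastCases with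
    | last => simpa using h3
    | cast i =>
      have h4 := (hwpos i).not_gt
      rw [hI]
      simp only [h4, Set.mem_singleton_iff, false_iff]
      exact (Fin.castSucc_lt_last i).ne
  subst hIeq
  have hzp : (z : Plane) = p := by simpa using hz
  have hhull : (p : Plane) ∈ convexHull ℝ ((fun i => (x i : Plane)) '' Set.univ) := by
    rw [← hzp]
    refine convexHull_mono ?_ hz'
    rintro _ ⟨i, hi, rfl⟩
    induction i using Fin.lastCases with
    | last => exact absurd rfl hi
    | cast i => exact ⟨i, trivial, by fin_cases i <;> rfl⟩
  obtain ⟨α, α0, -, α1, hα⟩ := exists_weights_of_mem_convexHull_image _ _ hhull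
  have hind : AffineIndependent ℝ (fun i => f (x i)) := affineIndependent_of_area_ne_zero hA
  let B : AffineBasis (Fin 3) ℝ Plane :=
    ⟨fun i => f (x i), hind, hind.affineSpan_eq_top_iff_card_eq_finrank_add_one.mpr (by simp)⟩
  have hB : ∀ i, f (x i) = B i := fun i => rfl
  have hcomb : ∀ (w : Fin 3 → ℝ) (v : Plane), ∑ i, w i = 1 → v = ∑ i, w i • f (x i) →
      ∀ i, B.coord i v = w i := by
    intro w v hw hv i
    have : v = Finset.univ.affineCombination ℝ B w := by
      rw [Finset.affineCombination_eq_linear_combination _ _ _ hw]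
      exact hv
    rw [this]
    exact B.coord_apply_combination_of_mem (Finset.mem_univ i) hw
  have hpc : ∀ i, 0 < B.coord i (f p) := by
    intro i
    rw [hcomb ![r, s, t] (f p) (by simpa [Fin.sum_univ_three] using h1)
      (by simpa [Fin.sum_univ_three, hx] using hpe)]
    exact hwpos i
  have hαpos : ∀ i, 0 < α i := by
    intro i
    -- If α i were zero, p would lie in the hull of the other two points, and `f p` on the side
    -- opposite to vertex i.
    refine (α0 i).lt_of_ne' fun hi => ?_
    have hmem : (p : Plane) ∈ convexHull ℝ ((fun i => (x i : Plane)) '' {i}ᶜ) := by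
      rw [← hα]
      have e : ∑ j, α j • (x j : Plane) = ∑ j ∈ Finset.univ.erase i, α j • (x j : Plane) := by
        rw [← Finset.sum_erase_add _ _ (Finset.mem_univ i), hi, zero_smul, add_zero]
      have e1 : ∑ j ∈ Finset.univ.erase i, α j = 1 := by
        rw [← α1, ← Finset.sum_erase_add _ _ (Finset.mem_univ i), hi, add_zero]
      rw [e]
      exact (convex_convexHull ℝ _).sum_mem (fun j _ => α0 j) e1 fun j hj =>
        subset_convexHull ℝ _ ⟨j, by simpa using hj, rfl⟩
    obtain ⟨w, -, wI, w1, hw⟩ := exists_weights_of_mem_convexHull_image _ _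
      (hf.map_mem_convexHull hG x _ p hmem)
    have := hpc i
    rw [hcomb w (f p) w1 hw.symm, wI i (by simp)] at this
    exact lt_irrefl _ this
  have hsub := hf.openTriangle_subset_range hG B x p hB hpc α hαpos α1 hα
  have hopen : IsOpen {y | ∀ i, 0 < B.coord i y} := by
    rw [← B.interior_convexHull]
    exact isOpen_interior
  exact ⟨f p, interior_maximal hsub hopen hpc⟩

/-- If `a, d` and `b, c` are the pairs of opposite vertices of a convex quadrilateral with
vertices in the range, then the intersection of the diagonals is in the range. -/
theorem diagonal_mem_range {G : Set Plane} (hG : Convex ℝ G) {f : G → Plane}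
    (hf : BetweennessMonotone f) {a b c d : Plane} (ha : a ∈ Set.range f) (hb : b ∈ Set.range f)
    (hc : c ∈ Set.range f) (hd : d ∈ Set.range f) (hA : area a b c ≠ 0) {r s t : ℝ}
    (hr : r < 0) (hs : 0 < s) (ht : 0 < t) (h1 : r + s + t = 1)
    (hde : d = r • a + s • b + t • c) :
    ∃ e ∈ Set.range f, e ∈ segment ℝ a d ∧ e ∈ segment ℝ b c := by
  obtain ⟨a, rfl⟩ := ha
  obtain ⟨b, rfl⟩ := hb
  obtain ⟨c, rfl⟩ := hc
  obtain ⟨d, rfl⟩ := hd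
  obtain ⟨I, z, h3, hI, hz, hz'⟩ := hf.exists_radon_point hG ![a, b, c, d] ![r, s, t] (by
    intro i
    fin_cases i
    exacts [hr.ne, hs.ne', ht.ne']) h1 hA hde
  have h0 : 0 ∈ I := (hI 0).mpr hr
  have h1' : 1 ∉ I := fun h => hs.not_gt ((hI 1).mp h)
  have h2 : 2 ∉ I := fun h => ht.not_gt ((hI 2).mp h)
  refine ⟨f z, ⟨z, rfl⟩, ?_, ?_⟩
  · rw [← convexHull_pair]
    refine convexHull_mono ?_ (hf.map_mem_convexHull hG _ _ z hz)
    rintro _ ⟨i, hi, rfl⟩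
    fin_cases i
    · simp
    · exact absurd hi h1'
    · exact absurd hi h2
    · simp
  · rw [← convexHull_pair]
    refine convexHull_mono ?_ (hf.map_mem_convexHull hG _ _ z hz')
    rintro _ ⟨i, hi, rfl⟩
    fin_cases i
    · exact absurd h0 hi
    · simp
    · simp
    · exact absurd h3 hi

end BetweennessMonotone

/-! ### Planar sets not covered by a line and a point -/

lemma inLineUnionPoint_of_forall {S : Set Plane} {a b : Plane} (hab : a ≠ b) (q : Plane)
    (h : ∀ x ∈ S, x ≠ q → ∃ t : ℝ, x = AffineMap.lineMap a b t) : InLineUnionPoint S := by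
  refine ⟨line[ℝ, a, b], q, ?_, fun x hx => ?_⟩
  · rw [direction_affineSpan, vectorSpan_pair]
    exact finrank_span_singleton (by simpa [sub_eq_zero] using hab)
  · by_cases hq : x = q
    · exact .inr hq
    · obtain ⟨t, rfl⟩ := h x hx hq
      exact .inl (AffineMap.lineMap_mem_affineSpan_pair t a b)

lemma exists_lineMap_of_area_eq_zero {a b x : Plane} (hab : a ≠ b) (h : area a b x = 0) :
    ∃ t : ℝ, x = AffineMap.lineMap a b t := by
  unfold area at h
  by_cases h0 : b 0 - a 0 = 0
  · have h1 : b 1 - a 1 ≠ 0 := by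
      intro h1
      apply hab
      ext i
      fin_cases i
      · simpa using (sub_eq_zero.mp h0).symm
      · simpa using (sub_eq_zero.mp h1).symm
    refine ⟨(x 1 - a 1) / (b 1 - a 1), ?_⟩
    ext i
    fin_cases i <;> simp [AffineMap.lineMap_apply] <;> field_simp <;> linarith
  · refine ⟨(x 0 - a 0) / (b 0 - a 0), ?_⟩
    ext i
    fin_cases i <;> simp [AffineMap.lineMap_apply] <;> field_simp <;> linarith

lemma exists_area_ne_zero {S : Set Plane} (hS : ¬ InLineUnionPoint S) :
    ∃ a ∈ S, ∃ b ∈ S, ∃ c ∈ S, area a b c ≠ 0 := by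
  by_contra! h
  apply hS
  by_cases hsub : S.Subsingleton
  · have h01 : (0 : Plane) ≠ EuclideanSpace.single 0 1 := by
      intro e
      simpa using congrArg (fun v : Plane => v 0) e
    rcases S.eq_empty_or_nonempty with rfl | ⟨q, hq⟩
    · exact inLineUnionPoint_of_forall h01 0 (by simp)
    · exact inLineUnionPoint_of_forall h01 q fun x hx hxq => absurd (hsub hx hq) hxq
  · obtain ⟨a, ha, b, hb, hab⟩ := Set.not_subsingleton_iff.mp hsub
    exact inLineUnionPoint_of_forall hab a fun x hx _ =>
      exists_lineMap_of_area_eq_zero hab (h a ha b hb x hx)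

/-- `S` contains a point of the line through `a` and `b` other than `a` and `b`. -/
def HasThirdPoint (S : Set Plane) (a b : Plane) : Prop :=
  ∃ r s : ℝ, r ≠ 0 ∧ s ≠ 0 ∧ r + s = 1 ∧ r • a + s • b ∈ S

lemma HasThirdPoint.symm {S : Set Plane} {a b : Plane} (h : HasThirdPoint S a b) :
    HasThirdPoint S b a := by
  obtain ⟨r, s, hr, hs, h1, hm⟩ := h
  exact ⟨s, r, hs, hr, by rwa [add_comm], by rwa [add_comm]⟩

/-- `S` contains four points no three of which are collinear. -/
def HasGeneralQuadruple (S : Set Plane) : Prop :=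
  ∃ a ∈ S, ∃ b ∈ S, ∃ c ∈ S, area a b c ≠ 0 ∧ ∃ r s t : ℝ, r ≠ 0 ∧ s ≠ 0 ∧ t ≠ 0 ∧
    r + s + t = 1 ∧ r • a + s • b + t • c ∈ S

lemma area_combination_left (a b c : Plane) {r s : ℝ} (h : r + s = 1) :
    area (r • a + s • b) b c = r * area a b c := by
  obtain rfl : s = 1 - r := by linarith
  simp [area]
  ring

/-- With d the third point on ab and e the one on ac, the quadruple is d, b, c, e: the weights of e
come from substituting a = (d - s b)/r into e = r' a + t c. -/
lemma HasThirdPoint.hasGeneralQuadruple {S : Set Plane} {a b c : Plane} (hb : b ∈ S)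
    (hc : c ∈ S) (hA : area a b c ≠ 0) (h : HasThirdPoint S a b) (h' : HasThirdPoint S a c) :
    HasGeneralQuadruple S := by
  obtain ⟨r, s, hr, hs, h1, hd⟩ := h
  obtain ⟨r', t, hr', ht, h1', he⟩ := h'
  refine ⟨_, hd, b, hb, c, hc, ?_, r' / r, -(r' * s / r), t, by positivity,
    neg_ne_zero.mpr (by positivity), ht, ?_, ?_⟩
  · rw [area_combination_left _ _ _ h1]
    exact mul_ne_zero hr hA
  · field_simp
    linear_combination (-r') * h1 + r * h1'
  · convert he using 1
    have e : r' = r' / r * r := by field_simp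
    rw [smul_add, smul_smul, smul_smul, ← e, show r' / r * s = r' * s / r by ring]
    module

/-- If neither line through a had a third point, every point of S other than a would have weight
zero at a, so S would lie in the line bc together with a. -/
lemma hasThirdPoint_or {S : Set Plane} (hS : ¬ InLineUnionPoint S)
    (hno : ¬ HasGeneralQuadruple S) {a b c : Plane} (ha : a ∈ S) (hb : b ∈ S) (hc : c ∈ S)
    (hA : area a b c ≠ 0) : HasThirdPoint S a b ∨ HasThirdPoint S a c := by
  by_contra! h
  apply hS
  have hbc : b ≠ c := by
    rintro rfl
    apply hA
    unfold area
    ring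
  refine inLineUnionPoint_of_forall hbc a fun x hx hxa => ?_
  obtain ⟨r, s, t, h1, rfl⟩ := exists_weights_of_area_ne_zero hA x
  by_cases hr : r = 0
  · subst hr
    obtain rfl : s = 1 - t := by linarith
    exact ⟨t, by rw [AffineMap.lineMap_apply_module, zero_smul, zero_add]⟩
  exfalso
  by_cases hs : s = 0
  · subst hs
    by_cases ht : t = 0
    · subst ht
      obtain rfl : r = 1 := by linarith
      simp at hxa
    · exact h.2 ⟨r, t, hr, ht, by linarith, by simpa using hx⟩
  · by_cases ht : t = 0
    · subst ht
      exact h.1 ⟨r, s, hr, hs, by linarith, by simpa using hx⟩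
    · exact hno ⟨a, ha, b, hb, c, hc, hA, r, s, t, hr, hs, ht, h1, hx⟩

/-- By `hasThirdPoint_or`, every vertex of a triangle in S is on a side line with a third point. So
at least two sides have one, and two sides share a vertex. -/
theorem hasGeneralQuadruple_of_not_inLineUnionPoint {S : Set Plane}
    (hS : ¬ InLineUnionPoint S) : HasGeneralQuadruple S := by
  obtain ⟨a, ha, b, hb, c, hc, hA⟩ := exists_area_ne_zero hS
  by_contra hno
  have hA₁ : area b c a ≠ 0 := by rwa [area_rotate]
  have hA₂ : area c a b ≠ 0 := by rwa [area_rotate, area_rotate]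
  have hA' : area b a c ≠ 0 := by rwa [area_swap, neg_ne_zero]
  have close : ∀ {a b c : Plane}, b ∈ S → c ∈ S → area a b c ≠ 0 → HasThirdPoint S a b →
      HasThirdPoint S a c → False := fun hb hc hA h h' =>
    hno (h.hasGeneralQuadruple hb hc hA h')
  rcases hasThirdPoint_or hS hno ha hb hc hA with h | h
  · rcases hasThirdPoint_or hS hno hc ha hb hA₂ with h' | h'
    · exact close hb hc hA h h'.symm
    · exact close ha hc hA' h.symm h'.symm
  · rcases hasThirdPoint_or hS hno hb hc ha hA₁ with h' | h'
    · exact close ha hb hA₂ h.symm h'.symm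
    · exact close hb hc hA h'.symm h

/-! ### Sets with no point in an open triangle -/

/-- No point of `S` lies in an open triangle with vertices in `S`. -/
def NoInteriorPoint (S : Set Plane) : Prop :=
  ∀ a ∈ S, ∀ b ∈ S, ∀ c ∈ S, ∀ r s t : ℝ, area a b c ≠ 0 → 0 < r → 0 < s → 0 < t →
    r + s + t = 1 → r • a + s • b + t • c ∉ S

namespace NoInteriorPoint

variable {S : Set Plane}

/-- Such a point g would put e strictly inside the triangle g a b. -/
lemma notMem_opposite_sector (hS : NoInteriorPoint S) {e a b : Plane} (he : e ∈ S) (ha : a ∈ S)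
    (hb : b ∈ S) (hA : area e a b ≠ 0) {α β : ℝ} (hα : 0 < α) (hβ : 0 < β) :
    e - α • (a - e) - β • (b - e) ∉ S := by
  intro hg
  have hpos : 0 < 1 + α + β := by positivity
  refine hS _ hg a ha b hb (1 / (1 + α + β)) (α / (1 + α + β)) (β / (1 + α + β)) ?_
    (by positivity) (by positivity) (by positivity) (by field_simp) ?_
  · have : area (e - α • (a - e) - β • (b - e)) a b = (1 + α + β) * area e a b := by
      simp [area]
      ring
    rw [this]
    exact mul_ne_zero hpos.ne' hA
  · convert he using 1
    ext i
    simp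
    field_simp
    ring

/-- Here e lies strictly between b and c = e - τ(b - e). Of two different points on the ray from e
through a, the nearer is strictly inside the triangle formed by the farther with b and c. -/
lemma eq_one_of_mem_diagonal (hS : NoInteriorPoint S) {e a b : Plane} {τ α : ℝ} (ha : a ∈ S)
    (hb : b ∈ S) (hA : area e a b ≠ 0) (hτ : 0 < τ) (hc : e - τ • (b - e) ∈ S)
    (hα : 0 < α) (hg : e + α • (a - e) ∈ S) : α = 1 := by
  rcases lt_trichotomy α 1 with h | h | h
  · refine absurd hg ?_
    have hα' : 0 < 1 - α := by linarith
    convert hS a ha b hb _ hc α ((1 - α) * τ / (1 + τ)) ((1 - α) / (1 + τ)) ?_ hα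
      (by positivity) (by positivity) (by field_simp; ring) using 2
    · ext i
      simp
      field_simp
      ring
    · have : area a b (e - τ • (b - e)) = (1 + τ) * area e a b := by
        simp [area]
        ring
      rw [this]
      exact mul_ne_zero (by positivity) hA
  · exact h
  · refine absurd ha ?_
    have hα' : 0 < α - 1 := by linarith
    convert hS _ hg b hb _ hc (1 / α) ((α - 1) * τ / (α * (1 + τ)))
      ((α - 1) / (α * (1 + τ))) ?_ (by positivity)
      (by positivity) (by positivity) (by field_simp; ring) using 2
    · ext i
      simp
      field_simp
      ring
    · have : area (e + α • (a - e)) b (e - τ • (b - e)) = α * (1 + τ) * area e a b := by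
        simp [area]
        ring
      rw [this]
      exact mul_ne_zero (by positivity) hA

/-- A set without interior points that contains a quadrilateral and the intersection of its
diagonals contains nothing else. -/
lemma eq_of_mem (hS : NoInteriorPoint S) {e a b : Plane} {κ τ : ℝ} (hA : area e a b ≠ 0)
    (hκ : 0 < κ) (hτ : 0 < τ) (he : e ∈ S) (ha : a ∈ S) (hb : b ∈ S)
    (hc : e - κ • (a - e) ∈ S) (hd : e - τ • (b - e) ∈ S) {g : Plane} (hg : g ∈ S) :
    g = a ∨ g = b ∨ g = e - κ • (a - e) ∨ g = e - τ • (b - e) ∨ g = e := by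
  obtain ⟨r, s, t, h1, rfl⟩ := exists_weights_of_area_ne_zero hA g
  obtain rfl : r = 1 - s - t := by linarith
  have hAc : area e (e - κ • (a - e)) b ≠ 0 := by
    have : area e (e - κ • (a - e)) b = -κ * area e a b := by simp [area]; ring
    rw [this]
    exact mul_ne_zero (neg_ne_zero.mpr hκ.ne') hA
  have hAd : area e a (e - τ • (b - e)) ≠ 0 := by
    have : area e a (e - τ • (b - e)) = -τ * area e a b := by simp [area]; ring
    rw [this]
    exact mul_ne_zero (neg_ne_zero.mpr hτ.ne') hA
  have hAcd : area e (e - κ • (a - e)) (e - τ • (b - e)) ≠ 0 := by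
    have : area e (e - κ • (a - e)) (e - τ • (b - e)) = κ * τ * area e a b := by
      simp [area]; ring
    rw [this]
    exact mul_ne_zero (by positivity) hA
  have flip : ∀ x y : Plane, area e x y ≠ 0 → area e y x ≠ 0 := by
    intro x y h
    have : area e y x = -area e x y := by unfold area; ring
    rwa [this, neg_ne_zero]
  -- With e as origin and axes along the diagonals, each open quadrant is the sector opposite to two
  -- vertices, each open half-axis holds only its vertex, and the origin is e.
  rcases lt_trichotomy s 0 with hs | rfl | hs <;> rcases lt_trichotomy t 0 with ht | rfl | ht
  · refine absurd ?_ (hS.notMem_opposite_sector he ha hb hA (neg_pos.mpr hs) (neg_pos.mpr ht))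
    convert hg using 1
    module
  · have h := hS.eq_one_of_mem_diagonal (α := -s / κ) hc hb hAc hτ hd
      (div_pos (neg_pos.mpr hs) hκ) (by
        convert hg using 1
        ext i
        simp
        field_simp
        ring)
    obtain rfl : s = -κ := by
      field_simp at h
      linarith
    exact .inr (.inr (.inl (by module)))
  · refine absurd ?_ (hS.notMem_opposite_sector he ha hd hAd (neg_pos.mpr hs) (div_pos ht hτ))
    convert hg using 1
    ext i
    simp
    field_simp
    ring
  · have h := hS.eq_one_of_mem_diagonal (α := -t / τ) hd ha (flip _ _ hAd) hκ hc
      (div_pos (neg_pos.mpr ht) hτ) (by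
        convert hg using 1
        ext i
        simp
        field_simp
        ring)
    obtain rfl : t = -τ := by
      field_simp at h
      linarith
    exact .inr (.inr (.inr (.inl (by module))))
  · exact .inr (.inr (.inr (.inr (by module))))
  · obtain rfl := hS.eq_one_of_mem_diagonal (α := t) hb ha (flip _ _ hA) hκ hc ht (by
        convert hg using 1
        module)
    exact .inr (.inl (by module))
  · refine absurd ?_ (hS.notMem_opposite_sector he hc hb hAc (div_pos hs hκ) (neg_pos.mpr ht))
    convert hg using 1
    ext i
    simp
    field_simp
    ring
  · obtain rfl := hS.eq_one_of_mem_diagonal (α := s) ha hb hA hτ hd hs (by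
        convert hg using 1
        module)
    exact .inl (by module)
  · refine absurd ?_ (hS.notMem_opposite_sector he hc hd hAcd (div_pos hs hκ) (div_pos ht hτ))
    convert hg using 1
    ext i
    simp
    field_simp
    ring

end NoInteriorPoint

lemma notMem_convexHull_image_of_separating {ι V : Type*} [AddCommGroup V] [Module ℝ V]
    (p : ι → V) (i : ι) (φ : V → ℝ)
    (hφ : ∀ x y r s, r + s = 1 → φ (r • x + s • y) = r * φ x + s * φ y) (hi : 0 < φ (p i))
    (hle : ∀ j, j ≠ i → φ (p j) ≤ 0) (s : Set ι) : p i ∉ convexHull ℝ (p '' (s \ {i})) := by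
  intro h
  have hconv : Convex ℝ {x | φ x ≤ 0} := by
    intro x hx y hy r s hr hs hrs
    simp only [Set.mem_ofPred_eq] at hx hy ⊢
    rw [hφ _ _ _ _ hrs]
    exact add_nonpos (mul_nonpos_of_nonneg_of_nonpos hr hx) (mul_nonpos_of_nonneg_of_nonpos hs hy)
  have hsub : p '' (s \ {i}) ⊆ {x | φ x ≤ 0} := by
    rintro _ ⟨j, hj, rfl⟩
    exact hle j hj.2
  exact hi.not_ge (convexHull_min hsub hconv h)

/-- Each vertex is cut off from the other three by the diagonal not through it. The factor ±`area e
a b` makes the functional positive at that vertex for either orientation. -/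
lemma convexIndependent_quadrilateral {e a b : Plane} {κ τ : ℝ} (hA : area e a b ≠ 0)
    (hκ : 0 < κ) (hτ : 0 < τ) :
    ConvexIndependent ℝ ![a, b, e - κ • (a - e), e - τ • (b - e)] := by
  rw [convexIndependent_iff_notMem_convexHull_sdiff]
  have hA2 : 0 < area e a b * area e a b := mul_self_pos.mpr hA
  have h1 : ∀ (c : ℝ) (x y : Plane) (r s : ℝ), r + s = 1 →
      c * area e (r • x + s • y) b = r * (c * area e x b) + s * (c * area e y b) := by
    intro c x y r s h
    obtain rfl : s = 1 - r := by linarith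
    simp [area]
    ring
  have h2 : ∀ (c : ℝ) (x y : Plane) (r s : ℝ), r + s = 1 →
      c * area e a (r • x + s • y) = r * (c * area e a x) + s * (c * area e a y) := by
    intro c x y r s h
    obtain rfl : s = 1 - r := by linarith
    simp [area]
    ring
  have e1 : area e b b = 0 := by unfold area; ring
  have e2 : area e a a = 0 := by unfold area; ring
  have e3 : area e (e - κ • (a - e)) b = -κ * area e a b := by simp [area]; ring
  have e4 : area e (e - τ • (b - e)) b = 0 := by simp [area]; ring
  have e5 : area e a (e - κ • (a - e)) = 0 := by simp [area]; ring
  have e6 : area e a (e - τ • (b - e)) = -τ * area e a b := by simp [area]; ring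
  have k1 := mul_pos hκ hA2
  have k2 := mul_pos hτ hA2
  intro i
  fin_cases i
  · refine notMem_convexHull_image_of_separating _ _ (fun x => area e a b * area e x b)
      (h1 _) hA2 fun j hj => ?_
    fin_cases j <;> simp [e1, e3, e4] at hj ⊢
    linarith
  · refine notMem_convexHull_image_of_separating _ _ (fun x => area e a b * area e a x)
      (h2 _) hA2 fun j hj => ?_
    fin_cases j <;> simp [e2, e5, e6] at hj ⊢
    linarith
  · refine notMem_convexHull_image_of_separating _ _ (fun x => -area e a b * area e x b)
      (h1 _) ?_ fun j hj => ?_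
    · simp [e3]; linarith
    · fin_cases j <;> simp [e1, e4] at hj ⊢
      exact hA2.le
  · refine notMem_convexHull_image_of_separating _ _ (fun x => -area e a b * area e a x)
      (h2 _) ?_ fun j hj => ?_
    · simp [e6]; linarith
    · fin_cases j <;> simp [e2, e5] at hj ⊢
      exact hA2.le

lemma segment_inter_segment_eq {e a b : Plane} {κ τ : ℝ} (hA : area e a b ≠ 0)
    (hκ : 0 < κ) (hτ : 0 < τ) :
    segment ℝ a (e - κ • (a - e)) ∩ segment ℝ b (e - τ • (b - e)) = {e} := by
  have hκ' : 0 < 1 + κ := by linarith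
  have hτ' : 0 < 1 + τ := by linarith
  refine Set.eq_singleton_iff_unique_mem.mpr ⟨⟨?_, ?_⟩, ?_⟩
  · refine ⟨κ / (1 + κ), 1 / (1 + κ), by positivity, by positivity, by field_simp; ring, ?_⟩
    ext i
    simp
    field_simp
    ring
  · refine ⟨τ / (1 + τ), 1 / (1 + τ), by positivity, by positivity, by field_simp; ring, ?_⟩
    ext i
    simp
    field_simp
    ring
  · rintro x ⟨⟨r, s, -, -, h1, rfl⟩, r', s', -, -, h1', h⟩
    obtain rfl : r = 1 - s := by linarith
    obtain rfl : r' = 1 - s' := by linarith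
    obtain ⟨-, h2, -⟩ := weights_eq_zero_of_area_ne_zero hA
      (r := s * (1 + κ) - s' * (1 + τ)) (s := 1 - s - s * κ) (t := s' * τ - (1 - s'))
      (by ring) (by
        rw [← sub_eq_zero.mpr h.symm]
        module)
    have hs : s * κ = 1 - s := by linarith
    have : (1 - s) • a + s • (e - κ • (a - e)) = e + (1 - s - s * κ) • (a - e) := by module
    rw [this, h2, zero_smul, add_zero]

/-! ### The trichotomy -/

/-- If the range has no interior points and contains a convex quadrilateral, then it consists of
the vertices of the quadrilateral and its center. -/
theorem BetweennessMonotone.isQuadrilateralWithCenter {G : Set Plane} (hG : Convex ℝ G)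
    {f : G → Plane} (hf : BetweennessMonotone f) (hS : NoInteriorPoint (Set.range f))
    {a b c : Plane} (ha : a ∈ Set.range f) (hb : b ∈ Set.range f) (hc : c ∈ Set.range f)
    (hA : area a b c ≠ 0) {r s t : ℝ} (hr : r < 0) (hs : 0 < s) (ht : 0 < t)
    (h1 : r + s + t = 1) (hd : r • a + s • b + t • c ∈ Set.range f) :
    IsQuadrilateralWithCenter (Set.range f) := by
  obtain ⟨e, he, had, hbc⟩ := hf.diagonal_mem_range hG ha hb hc hd hA hr hs ht h1 rfl
  obtain rfl : r = 1 - s - t := by linarith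
  have hst : 0 < s + t := by linarith
  -- Moving the a-term of d = r a + s b + t c to the other side and dividing by s + t gives the
  -- common point of the diagonals ad and bc.
  set e₀ : Plane := (s / (s + t)) • b + (t / (s + t)) • c with he₀
  have hAe : area e₀ a b = t / (s + t) * area a b c := by
    simp [he₀, area]
    field_simp
    ring
  have hAe' : area e₀ a b ≠ 0 := by
    rw [hAe]
    exact mul_ne_zero (by positivity) hA
  have hκ : 0 < s + t - 1 := by linarith
  have hτ : 0 < s / t := by positivity
  have hde : (1 - s - t) • a + s • b + t • c = e₀ - (s + t - 1) • (a - e₀) := by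
    ext i
    simp [he₀]
    field_simp
    ring
  have hce : c = e₀ - (s / t) • (b - e₀) := by
    ext i
    simp [he₀]
    field_simp
    ring
  have hinter := segment_inter_segment_eq hAe' hκ hτ
  obtain rfl : e = e₀ := by
    have : e ∈ ({e₀} : Set Plane) := by
      rw [← hinter, ← hde, ← hce]
      exact ⟨had, hbc⟩
    simpa using this
  rw [hde] at hd
  rw [hce] at hc
  refine ⟨_, _, _, _, _, ?_, convexIndependent_quadrilateral hAe' hκ hτ, hinter⟩
  refine Set.Subset.antisymm (fun g hg => ?_) ?_
  · simpa using hS.eq_of_mem hAe' hκ hτ he ha hb hd hc hg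
  · rintro _ (rfl | rfl | rfl | rfl | rfl)
    exacts [ha, hb, hd, hc, he]

theorem BetweennessMonotone.trichotomy {G : Set Plane} (hG : Convex ℝ G)
    {f : G → Plane} (hf : BetweennessMonotone f) :
    InLineUnionPoint (Set.range f) ∨ (interior (Set.range f)).Nonempty ∨
      IsQuadrilateralWithCenter (Set.range f) := by
  by_cases hL : InLineUnionPoint (Set.range f)
  · exact .inl hL
  refine .inr (or_iff_not_imp_left.mpr fun hI => ?_)
  have hS : NoInteriorPoint (Set.range f) := fun a ha b hb c hc r s t hA hr hs ht h1 hp =>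
    hI (hf.interior_range_nonempty hG ha hb hc hp hA hr hs ht h1 rfl)
  obtain ⟨a, ha, b, hb, c, hc, hA, r, s, t, hr, hs, ht, h1, hd⟩ :=
    hasGeneralQuadruple_of_not_inLineUnionPoint hL
  have rot : ∀ (a b c : Plane) (r s t : ℝ), s • b + t • c + r • a = r • a + s • b + t • c :=
    fun a b c r s t => by abel
  -- With two negative weights, solving for a expresses it as a strictly positive combination of the
  -- new point, b and c.
  have two_neg : ∀ {a b c : Plane} {r s t : ℝ}, a ∈ Set.range f → b ∈ Set.range f →
      c ∈ Set.range f → area a b c ≠ 0 → s < 0 → t < 0 → r + s + t = 1 →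
      r • a + s • b + t • c ∉ Set.range f := by
    intro a b c r s t ha hb hc hA hs ht h1 hd
    have hr : 0 < r := by linarith
    have hs' : 0 < -s := neg_pos.mpr hs
    have ht' : 0 < -t := neg_pos.mpr ht
    refine hS _ hd b hb c hc (1 / r) (-s / r) (-t / r) ?_ (by positivity) (by positivity)
      (by positivity) (by field_simp; linarith) ?_
    · have : area (r • a + s • b + t • c) b c = r * area a b c := by
        obtain rfl : r = 1 - s - t := by linarith
        simp [area]
        ring
      rw [this]
      exact mul_ne_zero hr.ne' hA
    · convert ha using 1
      ext i
      simp
      field_simp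
      ring
  have hA₁ : area b c a ≠ 0 := by rwa [area_rotate]
  have hA₂ : area c a b ≠ 0 := by rwa [area_rotate, area_rotate]
  have hd₁ : s • b + t • c + r • a ∈ Set.range f := by rwa [rot]
  have hd₂ : t • c + r • a + s • b ∈ Set.range f := by rwa [rot]
  -- The weights sum to one, so they are not all negative. One negative weight gives a convex
  -- quadrilateral; zero or two put one of the four points inside the triangle of the others.
  rcases hr.lt_or_gt with hr | hr <;> rcases hs.lt_or_gt with hs | hs <;>
    rcases ht.lt_or_gt with ht | ht
  · linarith
  · exact absurd hd₂ (two_neg hc ha hb hA₂ hr hs (by linarith))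
  · exact absurd hd₁ (two_neg hb hc ha hA₁ ht hr (by linarith))
  · exact hf.isQuadrilateralWithCenter hG hS ha hb hc hA hr hs ht h1 hd
  · exact absurd hd (two_neg ha hb hc hA hs ht h1)
  · exact hf.isQuadrilateralWithCenter hG hS hb hc ha hA₁ hs ht hr (by linarith) hd₁
  · exact hf.isQuadrilateralWithCenter hG hS hc ha hb hA₂ ht hr hs (by linarith) hd₂
  · exact absurd hd (hS a ha b hb c hc r s t hA hr hs ht h1)

/-! ### Mutual exclusion of the three cases -/

open MeasureTheory in
lemma interior_eq_empty_of_measure_zero {S : Set Plane} (h : (volume : Measure Plane) S = 0) :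
    interior S = ∅ := by
  by_contra hne
  exact (isOpen_interior.measure_pos volume (Set.nonempty_iff_ne_empty.mpr hne)).ne'
    (measure_mono_null interior_subset h)

lemma InLineUnionPoint.interior_eq_empty {S : Set Plane} (h : InLineUnionPoint S) :
    interior S = ∅ := by
  obtain ⟨L, q, hL, hS⟩ := h
  refine interior_eq_empty_of_measure_zero (MeasureTheory.measure_mono_null hS ?_)
  rw [MeasureTheory.measure_union_null_iff]
  refine ⟨MeasureTheory.Measure.addHaar_affineSubspace _ _ ?_, MeasureTheory.measure_singleton _⟩
  rintro rfl
  rw [AffineSubspace.direction_top, finrank_top] at hL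
  simp at hL

lemma IsQuadrilateralWithCenter.interior_eq_empty {S : Set Plane}
    (h : IsQuadrilateralWithCenter S) : interior S = ∅ := by
  obtain ⟨a, b, c, d, e, rfl, -⟩ := h
  exact interior_eq_empty_of_measure_zero (Set.Finite.measure_zero (Set.toFinite _) _)

lemma ConvexIndependent.eq_or_eq_of_wbtw {ι V : Type*} [AddCommGroup V] [Module ℝ V] {p : ι → V}
    (hp : ConvexIndependent ℝ p) {i j k : ι} (h : Wbtw ℝ (p i) (p j) (p k)) : j = i ∨ j = k := by
  have := hp {i, k} j (by
    rw [Set.image_pair, convexHull_pair]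
    exact mem_segment_iff_wbtw.mpr h)
  simpa using this

lemma ConvexIndependent.not_collinear {ι V : Type*} [AddCommGroup V] [Module ℝ V] {p : ι → V}
    (hp : ConvexIndependent ℝ p) {i j k : ι} (hij : i ≠ j) (hik : i ≠ k) (hjk : j ≠ k) :
    ¬ Collinear ℝ {p i, p j, p k} := by
  intro h
  rcases h.wbtw_or_wbtw_or_wbtw with h | h | h <;> rcases hp.eq_or_eq_of_wbtw h with h | h <;>
    first
    | exact hij h | exact hik h | exact hjk h | exact hij h.symm | exact hik h.symm
    | exact hjk h.symm

/-- At most one of the four distinct vertices equals q, so three would lie on the line, but convex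
independent points contain no collinear triple. -/
lemma IsQuadrilateralWithCenter.not_inLineUnionPoint {S : Set Plane}
    (h : IsQuadrilateralWithCenter S) : ¬ InLineUnionPoint S := by
  obtain ⟨a, b, c, d, e, rfl, hind, -⟩ := h
  rintro ⟨L, q, hL, hS⟩
  have hmem : ∀ i, ![a, b, c, d] i ∈ L ∨ ![a, b, c, d] i = q := by
    intro i
    refine hS ?_
    fin_cases i <;> simp
  have hcol : ∀ i j k, i ≠ j → i ≠ k → j ≠ k → ![a, b, c, d] i ∈ L → ![a, b, c, d] j ∈ L →
      ![a, b, c, d] k ∈ L → False := by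
    intro i j k hij hik hjk hi hj hk
    refine hind.not_collinear hij hik hjk ?_
    rw [collinear_iff_finrank_le_one, ← hL]
    refine Submodule.finrank_mono ?_
    rw [← direction_affineSpan]
    refine AffineSubspace.direction_le (affineSpan_le.mpr ?_)
    rintro _ (rfl | rfl | rfl)
    exacts [hi, hj, hk]
  have huniq : ∀ i j, i ≠ j → ![a, b, c, d] i = q → ![a, b, c, d] j ∈ L := fun i j hij hi =>
    (hmem j).resolve_right fun hj => hij (hind.injective (hi.trans hj.symm))
  by_cases hall : ∃ i, ![a, b, c, d] i = q
  · obtain ⟨i, hi⟩ := hall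
    obtain ⟨j, k, l, h1, h2, h3, h4, h5, h6⟩ : ∃ j k l : Fin 4, i ≠ j ∧ i ≠ k ∧ i ≠ l ∧ j ≠ k ∧
        j ≠ l ∧ k ≠ l := by
      clear hi
      revert i
      decide
    exact hcol j k l h4 h5 h6 (huniq _ _ h1 hi) (huniq _ _ h2 hi) (huniq _ _ h3 hi)
  · push Not at hall
    have hm := fun i => (hmem i).resolve_right (hall i)
    exact hcol 0 1 2 (by decide) (by decide) (by decide) (hm _) (hm _) (hm _)

theorem mainTheorem3 (G : Set Plane) (hG : Convex ℝ G) (f : G → Plane)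
    (hf : BetweennessMonotone f) :
    ExactlyOne (InLineUnionPoint (Set.range f))
      (interior (Set.range f)).Nonempty
      (IsQuadrilateralWithCenter (Set.range f)) := by
  refine ⟨hf.trichotomy hG, fun ⟨h1, h2⟩ => ?_, fun ⟨h1, h3⟩ => h3.not_inLineUnionPoint h1,
    fun ⟨h2, h3⟩ => ?_⟩
  · rw [h1.interior_eq_empty] at h2
    exact Set.not_nonempty_empty h2
  · rw [h3.interior_eq_empty] at h2
    exact Set.not_nonempty_empty h2
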